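/- Let $\theta\in(0,\pi)$ with $\theta\ne\pi/4,\pi/2,3\pi/4$, and put $c=\cos\theta$, $s=\sin\theta$. On $\ell^2(\mathbb Z)\otimes\mathbb C^2$, with the standard orthonormal bases $\{|x\rangle : x\in\mathbb Z\}$ and $\{|0\rangle,|1\rangle\}$, consider the unitary operators $$U_1=\sum_{x\in\mathbb Z}\Bigl\{|x-1\rangle\langle x|\otimes\tfrac c2\bigl(|0\rangle\langle0|-|1\rangle\langle0|+|0\rangle\langle1|-|1\rangle\langle1|\bigr)+|x\rangle\langle x|\otimes s\bigl(|0\rangle\langle1|+|1\rangle\langle0|\bigr)+|x+1\rangle\langle x|\otimes\tfrac c2\bigl(|0\rangle\langle0|+|1\rangle\langle0|-|0\rangle\langle1|-|1\rangle\langle1|\bigr)\Bigr\},$$ $$U_2=\sum_{x\in\mathbb Z}\Bigl\{|x-1\rangle\langle x|\otimes s|0\rangle\langle1|+|x\rangle\langle x|\otimes c\bigl(|0\rangle\langle0|-|1\rangle\langle1|\bigr)+|x+1\rangle\langle x|\otimes s|1\rangle\langle0|\Bigr\}.$$ Let $\alpha,\beta\in\mathbb C$ with $|\alpha|^2+|\beta|^2=1$,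 let $\Psi_0=|0\rangle\otimes(\alpha|0\rangle+\beta|1\rangle)$ and $\Psi_{t+1}=U_2U_1\Psi_t$ for $t=0,1,2,\dots$, and let $X_t$ be a $\mathbb Z$-valued random variable with $\mathbb P(X_t=x)=\|(\langle x|\otimes I)\Psi_t\|^2$. Put $$D(x)=1-4c^2s^2+c^2s^2x^2,\qquad \mathcal D=\bigl(\sqrt{1-2|c|s},\sqrt{1+2|c|s}\bigr),$$ $$W_+(x)=-2(1-2|c|s)+(1-|c|s)x^2+x\sqrt{D(x)},\qquad W_-(x)=2(1+2|c|s)-(1+|c|s)x^2-x\sqrt{D(x)},$$ $$f(x)=\frac{\bigl(x+2\sqrt{D(x)}\bigr)^2}{2\pi(4-x^2)\sqrt{D(x)}\sqrt{W_+(x)}\sqrt{W_-(x)}},$$ $$\nu_\pm(\alpha,\beta;x)=\frac1{2c^2-1}\Bigl\{\bigl(c^2x\mp\sqrt{D(x)}\bigr)\bigl(|\alpha|^2-|\beta|^2\bigr)-\bigl(s^2x\mp\sqrt{D(x)}\bigr)\bigl(\alpha\overline\beta+\overline\alpha\beta\bigr)\Bigr\},$$ $$\chi(x)=f(x)\bigl(1-\nu_+(\alpha,\beta;x)\bigr)I_{\mathcal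 D}(x)+f(-x)\bigl(1-\nu_-(\alpha,\beta;x)\bigr)I_{\mathcal D}(-x),$$ where $I_{\mathcal D}$ is the indicator function of $\mathcal D$ and each summand of $\chi$ is read as $0$ where its indicator vanishes. Then $\chi$ is a probability density on $\mathbb R$ that vanishes outside $(-\mathcal D)\cup\mathcal D$, and for every real $x$ $$\lim_{t\to\infty}\mathbb P\Bigl(\frac{X_t}t\le x\Bigr)=\int_{-\infty}^x\chi(y)\,dy;$$ that is, $X_t/t$ converges weakly to the absolutely continuous law with density $\chi$. In particular the distribution has a gap around the origin: $\sqrt{1-2|c|s}>0$ and $\mathbb P\bigl(|X_t/t|\le\sqrt{1-2|c|s}\bigr)\to0$ as $t\to\infty$. -/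

import Mathlib

open MeasureTheory Filter Topology

noncomputable section

namespace GapWalk

/-- The coin space, with orthonormal basis `|0⟩ = (1,0)`, `|1⟩ = (0,1)`. -/
abbrev Coin : Type := EuclideanSpace ℂ (Fin 2)

/-- The Hilbert space of the walker: the tensor product of the position space `ℓ²(ℤ)` and the coin
space, realised as the space of square-summable functions from `ℤ` to the coin space. The vector
`|x⟩ ⊗ φ` is the function supported at `x` with value `φ`. -/
abbrev State : Type := lp (fun _ : ℤ => Coin) 2

theorem memlp_shift (d : ℤ) (M : Matrix (Fin 2) (Fin 2) ℂ) (Ψ : State) :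
    Memℓp (fun x : ℤ => Matrix.toEuclideanCLM (𝕜 := ℂ) M (Ψ (x - d))) 2 := by
  have h2 : (0 : ℝ) < (2 : ENNReal).toReal := by norm_num
  refine memℓp_gen ?_
  have h1 : Summable fun x : ℤ => ‖Ψ (x - d)‖ ^ (2 : ENNReal).toReal :=
    ((Equiv.subRight d).summable_iff (f := fun x : ℤ => ‖Ψ x‖ ^ (2 : ENNReal).toReal)).2
      ((lp.memℓp Ψ).summable h2)
  refine Summable.of_nonneg_of_le (fun x => by positivity) (fun x => ?_)
    (h1.mul_left (‖Matrix.toEuclideanCLM (𝕜 := ℂ) M‖ ^ (2 : ENNReal).toReal))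
  rw [← Real.mul_rpow (norm_nonneg _) (norm_nonneg _)]
  exact Real.rpow_le_rpow (norm_nonneg _) (ContinuousLinearMap.le_opNorm _ _) h2.le

/-- The operator `∑ₓ |x + d⟩⟨x| ⊗ M` on the space of the walker. -/
def shift (d : ℤ) (M : Matrix (Fin 2) (Fin 2) ℂ) : State →ₗ[ℂ] State where
  toFun Ψ := ⟨fun x : ℤ => Matrix.toEuclideanCLM (𝕜 := ℂ) M (Ψ (x - d)), memlp_shift d M Ψ⟩
  map_add' Ψ Φ := by
    ext x : 2
    exact map_add (Matrix.toEuclideanCLM (𝕜 := ℂ) M) (Ψ (x - d)) (Φ (x - d))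
  map_smul' a Ψ := by
    ext x : 2
    exact map_smul (Matrix.toEuclideanCLM (𝕜 := ℂ) M) a (Ψ (x - d))

/-- The first operation. The matrix of `|i⟩⟨j|` has its entry in row `i` and column `j`. -/
def U₁ (θ : ℝ) : State →ₗ[ℂ] State :=
  shift (-1) (((Real.cos θ / 2 : ℝ) : ℂ) • !![1, 1; -1, -1])
    + shift 0 (((Real.sin θ : ℝ) : ℂ) • !![0, 1; 1, 0])
    + shift 1 (((Real.cos θ / 2 : ℝ) : ℂ) • !![1, -1; 1, -1])

/-- The second operation. -/
def U₂ (θ : ℝ) : State →ₗ[ℂ] State :=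
  shift (-1) (((Real.sin θ : ℝ) : ℂ) • !![0, 1; 0, 0])
    + shift 0 (((Real.cos θ : ℝ) : ℂ) • !![1, 0; 0, -1])
    + shift 1 (((Real.sin θ : ℝ) : ℂ) • !![0, 0; 1, 0])

/-- The state at time `t` of the walk started in `|0⟩ ⊗ (α|0⟩ + β|1⟩)`. -/
def walk (θ : ℝ) (α β : ℂ) : ℕ → State
  | 0 => lp.single 2 (0 : ℤ) (!₂[α, β] : Coin)
  | t + 1 => U₂ θ (U₁ θ (walk θ α β t))

/-- The law on `ℤ` of the position `X_t`: the mass at `x` is the squared norm of the component of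
the state at the position `x`. -/
def positionLaw (θ : ℝ) (α β : ℂ) (t : ℕ) : Measure ℤ :=
  Measure.sum fun x : ℤ => ENNReal.ofReal (‖walk θ α β t x‖ ^ 2) • Measure.dirac x

/-- `|c| s`, where `c = cos θ` and `s = sin θ`. -/
def cs (θ : ℝ) : ℝ := |Real.cos θ| * Real.sin θ

/-- `D(x) = 1 - 4c²s² + c²s²x²`. -/
def D (θ x : ℝ) : ℝ :=
  1 - 4 * Real.cos θ ^ 2 * Real.sin θ ^ 2 + Real.cos θ ^ 2 * Real.sin θ ^ 2 * x ^ 2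

def Wplus (θ x : ℝ) : ℝ :=
  -2 * (1 - 2 * cs θ) + (1 - cs θ) * x ^ 2 + x * √(D θ x)

def Wminus (θ x : ℝ) : ℝ :=
  2 * (1 + 2 * cs θ) - (1 + cs θ) * x ^ 2 - x * √(D θ x)

def f (θ x : ℝ) : ℝ :=
  (x + 2 * √(D θ x)) ^ 2 /
    (2 * Real.pi * (4 - x ^ 2) * √(D θ x) * √(Wplus θ x) * √(Wminus θ x))

/-- `ν₊` for `ε = 1` and `ν₋` for `ε = -1`. The number `α β̄ + ᾱ β` is real. -/
def nu (ε θ : ℝ) (α β : ℂ) (x : ℝ) : ℝ :=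
  1 / (2 * Real.cos θ ^ 2 - 1) *
    ((Real.cos θ ^ 2 * x - ε * √(D θ x)) * (‖α‖ ^ 2 - ‖β‖ ^ 2)
      - (Real.sin θ ^ 2 * x - ε * √(D θ x)) * (α * star β + star α * β).re)

/-- The inner and outer edges of the distribution. -/
def innerEdge (θ : ℝ) : ℝ := √(1 - 2 * cs θ)

def outerEdge (θ : ℝ) : ℝ := √(1 + 2 * cs θ)

/-- The limit density. -/
def density (θ : ℝ) (α β : ℂ) (x : ℝ) : ℝ :=
  f θ x * (1 - nu 1 θ α β x) * (Set.Ioo (innerEdge θ) (outerEdge θ)).indicator 1 x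
    + f θ (-x) * (1 - nu (-1) θ α β x) * (Set.Ioo (innerEdge θ) (outerEdge θ)).indicator 1 (-x)

/-- The limit law, absolutely continuous with respect to Lebesgue measure. -/
def limitLaw (θ : ℝ) (α β : ℂ) : Measure ℝ :=
  volume.withDensity fun x => ENNReal.ofReal (density θ α β x)

end GapWalk

end

/-!
By translation invariance one step of the walk acts, in the Fourier variable `k`, as a unitary
`2 × 2` matrix. The symbols of `U₁` and `U₂` are both of the form `n · σ` with `n` a unit vector and
`σ` the Pauli matrices, so that the symbol of a step is `z₊ P₊ + z₋ P₋`, where `P₊` and `P₋` are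
the spectral projections of a single reflection. After `t` steps the characteristic function of
`X_t / t` at `ξ` is, by Parseval's identity, an integral over `k` of an inner product of the Fourier
transforms at `k` and at `k - ξ / t`, in which the `t`-th powers of the eigenvalues combine to
`exp (i ξ v)` in the limit, `v` being the group velocity of the band; different bands do not
interfere since their components are orthogonal. The limit law is therefore that of the group
velocity, drawn with `k` uniform on `(-π, π)` and with the weights of the initial state on the two
bands.

With `a = cos θ sin θ` and `w = 1 - a cos k`, the group velocities are `±(2w - 1) / √(w² - a²)`.
This is strictly monotone in `k` on `[0, π]` and maps `(0, π)` onto the interval between the two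
edges, so the density is obtained by the change of variables from `k` to the speed, after the
weights have been symmetrized in `k`.
-/

noncomputable section

namespace GapWalk

open Complex (I)

section Fourier

variable {E : Type*} [NormedAddCommGroup E] [InnerProductSpace ℂ E]

/-- The character `x ↦ e^{-ikx}` of `ℤ`; the Fourier transform of `Ψ` is the sum of
`wave k x • Ψ x`, in which a displacement by `d` becomes multiplication by `wave k d`. -/
def wave (k : ℝ) (x : ℤ) : ℂ := Complex.exp (-(k * x : ℝ) * I)

@[fun_prop]
theorem continuous_wave (x : ℤ) : Continuous fun k => wave k x := by
  unfold wave; fun_prop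

theorem wave_zero_left (x : ℤ) : wave 0 x = 1 := by simp [wave]

theorem wave_add (k : ℝ) (x y : ℤ) : wave k (x + y) = wave k x * wave k y := by
  rw [wave, wave, wave, ← Complex.exp_add]; congr 1; push_cast; ring

theorem conj_wave_mul_wave_sub (k η : ℝ) (x y : ℤ) :
    starRingEnd ℂ (wave k x) * wave (k - η) y = wave k (y - x) * wave (-η) y := by
  simp only [wave, ← Complex.exp_conj, ← Complex.exp_add, map_mul, map_neg, Complex.conj_ofReal,
    Complex.conj_I]
  congr 1; push_cast; ring

theorem integral_wave (n : ℤ) :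
    ∫ k in (-Real.pi)..Real.pi, wave k n = if n = 0 then 2 * (Real.pi : ℂ) else 0 := by
  split_ifs with h
  · simp only [h, wave, Int.cast_zero, mul_zero, Complex.ofReal_zero, neg_zero, zero_mul,
      Complex.exp_zero, intervalIntegral.integral_const, Complex.real_smul]
    push_cast; ring
  · have hc : (-n * I : ℂ) ≠ 0 := by simp [h]
    have hexp : ∀ k : ℝ, wave k n = Complex.exp ((-n * I) * k) := fun k => by
      rw [wave]; congr 1; push_cast; ring
    simp only [hexp]
    rw [integral_exp_mul_complex hc, div_eq_zero_iff, sub_eq_zero]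
    exact .inl (Complex.exp_eq_exp_iff_exists_int.2 ⟨-n, by push_cast; ring⟩)

theorem integral_inner_sum_wave (S : Finset ℤ) (Ψ : ℤ → E) (η : ℝ) :
    ∫ k in (-Real.pi)..Real.pi,
        inner ℂ (∑ x ∈ S, wave k x • Ψ x) (∑ y ∈ S, wave (k - η) y • Ψ y)
      = 2 * Real.pi * ∑ x ∈ S, wave (-η) x * (‖Ψ x‖ : ℂ) ^ 2 := by
  have hexpand : ∀ k : ℝ, inner ℂ (∑ x ∈ S, wave k x • Ψ x) (∑ y ∈ S, wave (k - η) y • Ψ y)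
      = ∑ x ∈ S, ∑ y ∈ S, wave k (y - x) * (wave (-η) y * inner ℂ (Ψ x) (Ψ y)) := fun k => by
    rw [sum_inner]
    refine Finset.sum_congr rfl fun x _ => ?_
    rw [inner_sum]
    refine Finset.sum_congr rfl fun y _ => ?_
    rw [inner_smul_left, inner_smul_right, ← mul_assoc, ← mul_assoc, conj_wave_mul_wave_sub]
  simp only [hexpand]
  rw [intervalIntegral.integral_finsetSum fun x _ =>
    Continuous.intervalIntegrable (by fun_prop) _ _, Finset.mul_sum]
  refine Finset.sum_congr rfl fun x hx => ?_
  rw [intervalIntegral.integral_finsetSum fun y _ =>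
    Continuous.intervalIntegrable (by fun_prop) _ _]
  simp only [intervalIntegral.integral_mul_const, integral_wave, sub_eq_zero, ite_mul, zero_mul]
  rw [Finset.sum_ite_eq_of_mem' S x _ hx, inner_self_eq_norm_sq_to_K]
  rfl

theorem hasSum_wave_mul_norm_sq {Ψ : ℤ → E} {F : ℝ → E} (hΨ : Ψ.support.Finite)
    (hF : ∀ k, HasSum (fun x => wave k x • Ψ x) (F k)) (η : ℝ) :
    HasSum (fun x => wave (-η) x * (‖Ψ x‖ : ℂ) ^ 2)
      ((2 * Real.pi : ℂ)⁻¹ * ∫ k in (-Real.pi)..Real.pi, inner ℂ (F k) (F (k - η))) := by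
  have hzero : ∀ x ∉ hΨ.toFinset, Ψ x = 0 := fun x hx => by simpa using hx
  have hsum : ∀ k, F k = ∑ x ∈ hΨ.toFinset, wave k x • Ψ x := fun k =>
    (hF k).unique (hasSum_sum_of_ne_finset_zero fun x hx => by rw [hzero x hx, smul_zero])
  have hpi : (2 * Real.pi : ℂ) ≠ 0 := by exact_mod_cast Real.two_pi_pos.ne'
  simp only [hsum]
  rw [integral_inner_sum_wave, inv_mul_cancel_left₀ hpi]
  exact hasSum_sum_of_ne_finset_zero fun x hx => by simp [hzero x hx]

end Fourier

section BornLaw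

variable {E : Type*} [NormedAddCommGroup E]

/-- The law of the position of a particle in the state `Ψ`: the mass at `x` is `‖Ψ x‖ ^ 2`. -/
def bornLaw {X : Type*} [MeasurableSpace X] (Ψ : X → E) : Measure X :=
  Measure.sum fun x => ENNReal.ofReal (‖Ψ x‖ ^ 2) • Measure.dirac x

theorem isProbabilityMeasure_bornLaw_of_hasSum {X : Type*} [MeasurableSpace X] {Ψ : X → E}
    (h : HasSum (fun x => ‖Ψ x‖ ^ 2) 1) : IsProbabilityMeasure (bornLaw Ψ) := by
  constructor
  rw [bornLaw, Measure.sum_apply _ MeasurableSet.univ]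
  simp only [Measure.smul_apply, measure_univ, smul_eq_mul, mul_one]
  rw [← ENNReal.ofReal_tsum_of_nonneg (fun _ => sq_nonneg _) h.summable, h.tsum_eq,
    ENNReal.ofReal_one]

variable [InnerProductSpace ℂ E] {Ψ : ℤ → E} {F : ℝ → E}

theorem isProbabilityMeasure_bornLaw (hΨ : Ψ.support.Finite)
    (hF : ∀ k, HasSum (fun x => wave k x • Ψ x) (F k)) (hnorm : ∀ k, ‖F k‖ = 1) :
    IsProbabilityMeasure (bornLaw Ψ) := by
  refine isProbabilityMeasure_bornLaw_of_hasSum ?_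
  have hpi : (Real.pi : ℂ) ≠ 0 := by exact_mod_cast Real.pi_ne_zero
  have hone : (2 * Real.pi : ℂ)⁻¹ * ∫ k in (-Real.pi)..Real.pi, inner ℂ (F k) (F (k - 0))
      = (1 : ℝ) := by
    simp only [sub_zero, inner_self_eq_norm_sq_to_K, hnorm, intervalIntegral.integral_const,
      Complex.real_smul, RCLike.ofReal_one, one_pow]
    push_cast; field_simp; norm_num
  have h := hasSum_wave_mul_norm_sq hΨ hF 0
  simp only [neg_zero, wave_zero_left, one_mul] at h
  rw [hone] at h
  exact_mod_cast h

theorem charFun_map_bornLaw (hΨ : Ψ.support.Finite)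
    (hF : ∀ k, HasSum (fun x => wave k x • Ψ x) (F k)) (r ξ : ℝ) :
    charFun ((bornLaw Ψ).map fun n : ℤ => (n : ℝ) / r) ξ
      = (2 * Real.pi : ℂ)⁻¹ * ∫ k in (-Real.pi)..Real.pi, inner ℂ (F k) (F (k - ξ / r)) := by
  rw [charFun_apply_real, integral_map (by fun_prop)
    (Continuous.aestronglyMeasurable (by fun_prop)), bornLaw,
    integral_sum_dirac fun _ => ENNReal.ofReal_ne_top, ← (hasSum_wave_mul_norm_sq hΨ hF _).tsum_eq]
  refine tsum_congr fun x => ?_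
  rw [ENNReal.toReal_ofReal (sq_nonneg _), Complex.real_smul, mul_comm, Complex.ofReal_pow, wave]
  congr 2
  push_cast; ring

end BornLaw

section BandSystem

theorem tendsto_conj_mul_pow {z : ℝ → ℂ} {v k : ℝ} (hz : HasDerivAt z (-(v * I) * z k) k)
    (hnorm : ‖z k‖ = 1) (ξ : ℝ) :
    Tendsto (fun t : ℕ => (starRingEnd ℂ (z k) * z (k - ξ / t)) ^ t) atTop
      (𝓝 (Complex.exp (ξ * v * I))) := by
  have hone : starRingEnd ℂ (z k) * z k = 1 := by
    rw [Complex.conj_mul', hnorm, Complex.ofReal_one, one_pow]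
  have hderiv : HasDerivAt (fun η : ℝ => starRingEnd ℂ (z k) * z (k - ξ * η))
      (ξ * v * I) 0 := by
    have hline : HasDerivAt (fun η : ℝ => k - ξ * η) (-ξ) 0 := by
      simpa using ((hasDerivAt_id (0 : ℝ)).const_mul ξ).const_sub k
    have hz' : HasDerivAt z (-(v * I) * z k) (k - ξ * 0) := by rwa [mul_zero, sub_zero]
    refine ((hz'.scomp (0 : ℝ) hline).const_mul (starRingEnd ℂ (z k))).congr_deriv ?_
    rw [Complex.real_smul, Complex.ofReal_neg]
    linear_combination ξ * v * I * hone
  have hinv : Tendsto (fun t : ℕ => ((t : ℝ))⁻¹) atTop (𝓝[≠] 0) :=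
    tendsto_nhdsWithin_iff.2 ⟨tendsto_inv_atTop_nhds_zero_nat,
      (eventually_ne_atTop 0).mono fun t ht => inv_ne_zero (Nat.cast_ne_zero.2 ht)⟩
  have hslope : Tendsto (fun t : ℕ => (t : ℂ) * (starRingEnd ℂ (z k) * z (k - ξ / t) - 1)) atTop
      (𝓝 (ξ * v * I)) :=
    ((hasDerivAt_iff_tendsto_slope.1 hderiv).comp hinv).congr fun t => by
      simp only [Function.comp_apply, slope_def_module, sub_zero, inv_inv, mul_zero, hone,
        Complex.real_smul, Complex.ofReal_natCast, div_eq_mul_inv]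
  exact (Complex.tendsto_one_add_pow_exp_of_tendsto hslope).congr fun t => by rw [add_sub_cancel]

variable {E : Type*} [NormedAddCommGroup E] [InnerProductSpace ℂ E]

theorem norm_sq_sum_of_pairwise_inner_eq_zero {ι : Type*} [Fintype ι] {x : ι → E}
    (hx : Pairwise fun i j => inner ℂ (x i) (x j) = 0) : ‖∑ i, x i‖ ^ 2 = ∑ i, ‖x i‖ ^ 2 := by
  have h : ∀ i, inner ℂ (x i) (∑ j, x j) = (‖x i‖ : ℂ) ^ 2 := fun i => by
    rw [inner_sum, Finset.sum_eq_single i (fun j _ hj => hx hj.symm) (by simp),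
      inner_self_eq_norm_sq_to_K]
    rfl
  have h' : (‖∑ i, x i‖ : ℂ) ^ 2 = ∑ i, (‖x i‖ : ℂ) ^ 2 := by
    rw [← Finset.sum_congr rfl fun i _ => h i, ← sum_inner, inner_self_eq_norm_sq_to_K]
    rfl
  exact_mod_cast h'

/-- The data of a translation-invariant evolution with finitely many bands: at wave number `k` the
band `j` has the eigenvalue `z j k`, of modulus one, the initial state has the component `φ j k`
along it, and `v j k` is the group velocity; the sign in `hasDerivAt` is that of `wave`, for which
the shift by one has the eigenvalue `e^{-ik}`. -/
structure IsBandSystem {ι : Type*} (z : ι → ℝ → ℂ) (v : ι → ℝ → ℝ) (φ : ι → ℝ → E) : Prop where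
  norm_eq_one : ∀ j k, ‖z j k‖ = 1
  hasDerivAt : ∀ j k, HasDerivAt (z j) (-(v j k * I) * z j k) k
  continuous_component : ∀ j, Continuous (φ j)
  inner_eq_zero : ∀ k, Pairwise fun i j => inner ℂ (φ i k) (φ j k) = 0

namespace IsBandSystem

variable {ι : Type*} {z : ι → ℝ → ℂ} {v : ι → ℝ → ℝ} {φ : ι → ℝ → E}

theorem continuous_eigenvalue (h : IsBandSystem z v φ) (j : ι) : Continuous (z j) :=
  continuous_iff_continuousAt.2 fun k => (h.hasDerivAt j k).continuousAt

theorem tendsto_pow_mul_inner [DecidableEq ι] (h : IsBandSystem z v φ) (i j : ι) (k ξ : ℝ) :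
    Tendsto (fun t : ℕ => (starRingEnd ℂ (z i k) * z j (k - ξ / t)) ^ t *
        inner ℂ (φ i k) (φ j (k - ξ / t))) atTop
      (𝓝 (if i = j then Complex.exp (ξ * v i k * I) * (‖φ i k‖ : ℂ) ^ 2 else 0)) := by
  have hk : Tendsto (fun t : ℕ => k - ξ / t) atTop (𝓝 k) := by
    simpa using (tendsto_const_div_atTop_nhds_zero_nat ξ).const_sub k
  have hinner : Tendsto (fun t : ℕ => inner ℂ (φ i k) (φ j (k - ξ / t))) atTop
      (𝓝 (inner ℂ (φ i k) (φ j k))) :=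
    tendsto_const_nhds.inner (((h.continuous_component j).tendsto k).comp hk)
  split_ifs with hij
  · subst hij
    rw [inner_self_eq_norm_sq_to_K] at hinner
    exact (tendsto_conj_mul_pow (h.hasDerivAt i k) (h.norm_eq_one i k) ξ).mul hinner
  · rw [h.inner_eq_zero k hij, tendsto_zero_iff_norm_tendsto_zero] at hinner
    rw [tendsto_zero_iff_norm_tendsto_zero]
    simpa only [norm_mul, norm_pow, RCLike.norm_conj, h.norm_eq_one, mul_one, one_pow, one_mul]
      using hinner

variable [Fintype ι]

theorem tendsto_inner_sum (h : IsBandSystem z v φ) (k ξ : ℝ) :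
    Tendsto (fun t : ℕ => inner ℂ (∑ i, z i k ^ t • φ i k)
        (∑ j, z j (k - ξ / t) ^ t • φ j (k - ξ / t))) atTop
      (𝓝 (∑ i, Complex.exp (ξ * v i k * I) * (‖φ i k‖ : ℂ) ^ 2)) := by
  classical
  have hlim := tendsto_finsetSum Finset.univ fun i _ =>
    tendsto_finsetSum Finset.univ fun j _ => h.tendsto_pow_mul_inner i j k ξ
  simp only [Finset.sum_ite_eq, Finset.mem_univ, if_true] at hlim
  refine hlim.congr fun t => ?_
  simp only [sum_inner, inner_sum, inner_smul_left, inner_smul_right, map_pow, mul_pow,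
    mul_assoc, Finset.mul_sum]
  rw [Finset.sum_comm]
  refine Finset.sum_congr rfl fun i _ => Finset.sum_congr rfl fun j _ => ?_
  ring

theorem norm_sum_pow_smul (h : IsBandSystem z v φ) (t : ℕ) (k : ℝ) :
    ‖∑ j, z j k ^ t • φ j k‖ = ‖∑ j, φ j k‖ := by
  have horth : Pairwise fun i j => inner ℂ (z i k ^ t • φ i k) (z j k ^ t • φ j k) = 0 :=
    fun i j hij => by
      simp only [inner_smul_left, inner_smul_right, h.inner_eq_zero k hij, mul_zero]
  rw [← sq_eq_sq₀ (norm_nonneg _) (norm_nonneg _), norm_sq_sum_of_pairwise_inner_eq_zero horth,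
    norm_sq_sum_of_pairwise_inner_eq_zero (h.inner_eq_zero k)]
  simp only [norm_smul, norm_pow, h.norm_eq_one, one_pow, one_mul]

theorem exists_norm_inner_sum_le (h : IsBandSystem z v φ) (ξ : ℝ) :
    ∃ C : ℝ, ∀ t : ℕ, ∀ k ∈ Set.uIoc (-Real.pi) Real.pi,
      ‖inner ℂ (∑ j, z j k ^ t • φ j k) (∑ j, z j (k - ξ / t) ^ t • φ j (k - ξ / t))‖ ≤ C := by
  have hφ := h.continuous_component
  obtain ⟨B, hB⟩ := isCompact_Icc.exists_bound_of_continuousOn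
    (s := Set.Icc (-Real.pi - |ξ|) (Real.pi + |ξ|)) (f := fun k => ∑ j, φ j k) (by fun_prop)
  have hle : ∀ t : ℕ, ∀ k ∈ Set.Icc (-Real.pi - |ξ|) (Real.pi + |ξ|),
      ‖∑ j, z j k ^ t • φ j k‖ ≤ B := fun t k hk =>
    (h.norm_sum_pow_smul t k).trans_le (hB k hk)
  refine ⟨B * B, fun t k hk => (norm_inner_le_norm _ _).trans ?_⟩
  have hξ : |ξ / t| ≤ |ξ| := by
    rw [abs_div, Nat.abs_cast]
    exact div_nat_le_self_of_nonnneg (abs_nonneg ξ) t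
  rw [Set.uIoc_of_le (by linarith [Real.pi_pos])] at hk
  have hk₁ := hle t k ⟨by linarith [hk.1, abs_nonneg ξ], by linarith [hk.2, abs_nonneg ξ]⟩
  have hk₂ := hle t (k - ξ / t) ⟨by linarith [hk.1, abs_le.1 hξ], by linarith [hk.2, abs_le.1 hξ]⟩
  exact mul_le_mul hk₁ hk₂ (norm_nonneg _) ((norm_nonneg _).trans hk₁)

/-- The weak limit theorem of Grimmett, Janson and Scudo. -/
theorem tendsto_charFun_bornLaw (h : IsBandSystem z v φ) {Ψ : ℕ → ℤ → E}
    (hΨ : ∀ t, (Ψ t).support.Finite)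
    (hF : ∀ t k, HasSum (fun x => wave k x • Ψ t x) (∑ j, z j k ^ t • φ j k)) (ξ : ℝ) :
    Tendsto (fun t : ℕ => charFun ((bornLaw (Ψ t)).map fun n : ℤ => (n : ℝ) / t) ξ) atTop
      (𝓝 ((2 * Real.pi : ℂ)⁻¹ * ∫ k in (-Real.pi)..Real.pi,
        ∑ j, Complex.exp (ξ * v j k * I) * (‖φ j k‖ : ℂ) ^ 2)) := by
  simp only [fun t => charFun_map_bornLaw (hΨ t) (hF t)]
  obtain ⟨C, hC⟩ := h.exists_norm_inner_sum_le ξ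
  refine Tendsto.const_mul _ <|
    intervalIntegral.tendsto_integral_filter_of_dominated_convergence (fun _ => C)
      (.of_forall fun t => Continuous.aestronglyMeasurable ?_)
      (.of_forall fun t => .of_forall (hC t)) intervalIntegrable_const
      (.of_forall fun k _ => h.tendsto_inner_sum k ξ)
  have hz := h.continuous_eigenvalue
  have hφ := h.continuous_component
  fun_prop

end IsBandSystem

end BandSystem

section Reflection

variable {𝕜 E : Type*} [RCLike 𝕜] [NormedAddCommGroup E] [InnerProductSpace 𝕜 E]

/-- The component of `v` in the eigenspace of the reflection `A` for the eigenvalue `ε`. -/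
def reflectionPart (A : E →L[𝕜] E) (ε : ℤˣ) (v : E) : E := (2⁻¹ : 𝕜) • (v + (ε : ℤ) • A v)

theorem sum_reflectionPart (A : E →L[𝕜] E) (v : E) : ∑ ε : ℤˣ, reflectionPart A ε v = v := by
  rw [UnitsInt.univ, Finset.sum_pair (by decide), reflectionPart, reflectionPart]
  simp only [Units.val_one, Units.val_neg, one_smul, neg_smul]
  module

theorem apply_reflectionPart {A : E →L[𝕜] E} {v : E} (hA : A (A v) = v) (ε : ℤˣ) :
    A (reflectionPart A ε v) = (ε : ℤ) • reflectionPart A ε v := by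
  rw [reflectionPart, map_smul, map_add, map_zsmul, hA, smul_comm, smul_add (ε : ℤ), smul_smul,
    ← Units.val_mul, Int.units_mul_self, Units.val_one, one_smul, add_comm]

theorem norm_apply_of_involutive {A : E →L[𝕜] E} {v : E} (hsymm : (A : E →ₗ[𝕜] E).IsSymmetric)
    (hA : A (A v) = v) : ‖A v‖ = ‖v‖ := by
  have h : inner 𝕜 (A v) (A v) = inner 𝕜 v v := by
    simpa only [hA, ContinuousLinearMap.coe_coe] using hsymm v (A v)
  rw [@norm_eq_sqrt_re_inner 𝕜, h, ← @norm_eq_sqrt_re_inner 𝕜]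

theorem inner_reflectionPart_of_ne {A : E →L[𝕜] E} {v : E}
    (hsymm : (A : E →ₗ[𝕜] E).IsSymmetric) (hA : A (A v) = v) {ε δ : ℤˣ} (hεδ : ε ≠ δ) :
    inner 𝕜 (reflectionPart A ε v) (reflectionPart A δ v) = 0 := by
  have h : ((ε : ℤ) : 𝕜) * inner 𝕜 (reflectionPart A ε v) (reflectionPart A δ v)
      = ((δ : ℤ) : 𝕜) * inner 𝕜 (reflectionPart A ε v) (reflectionPart A δ v) := by
    have := hsymm (reflectionPart A ε v) (reflectionPart A δ v)
    simpa only [ContinuousLinearMap.coe_coe, apply_reflectionPart hA, ← Int.cast_smul_eq_zsmul 𝕜,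
      inner_smul_left, inner_smul_right, map_intCast] using this
  have hne : ((ε : ℤ) : 𝕜) ≠ ((δ : ℤ) : 𝕜) := by exact_mod_cast hεδ
  exact (mul_eq_mul_right_iff.1 h).resolve_left hne

theorem norm_sq_reflectionPart {A : E →L[𝕜] E} {v : E} (hsymm : (A : E →ₗ[𝕜] E).IsSymmetric)
    (hA : A (A v) = v) (ε : ℤˣ) :
    ‖reflectionPart A ε v‖ ^ 2 = (‖v‖ ^ 2 + (ε : ℤ) * RCLike.re (inner 𝕜 v (A v))) / 2 := by
  have hε : ‖(ε : ℤ) • A v‖ = ‖v‖ := by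
    rw [← norm_apply_of_involutive hsymm hA]
    rcases Int.units_eq_one_or ε with rfl | rfl <;> simp
  rw [reflectionPart, norm_smul, mul_pow, @norm_add_sq 𝕜, hε, ← Int.cast_smul_eq_zsmul 𝕜,
    inner_smul_right, ← RCLike.ofReal_intCast, RCLike.re_ofReal_mul, norm_inv, RCLike.norm_ofNat]
  ring

end Reflection

section Pauli

open Matrix

/-- The action of a matrix on the coin space. -/
abbrev coinOp (M : Matrix (Fin 2) (Fin 2) ℂ) : Coin →L[ℂ] Coin :=
  Matrix.toEuclideanCLM (𝕜 := ℂ) M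

/-- The combination `n · σ` of the Pauli matrices. -/
def pauli (n : Fin 3 → ℝ) : Matrix (Fin 2) (Fin 2) ℂ :=
  !![(n 2 : ℂ), n 0 - n 1 * I; n 0 + n 1 * I, -(n 2 : ℂ)]

/-- The point of the Bloch ball that represents the coin state `(α, β)`. -/
def blochVector (α β : ℂ) : Fin 3 → ℝ :=
  ![(α * star β + star α * β).re, 2 * (star α * β).im, ‖α‖ ^ 2 - ‖β‖ ^ 2]

@[fun_prop]
theorem continuous_pauli : Continuous pauli := by
  unfold pauli
  refine continuous_matrix fun i j => ?_
  fin_cases i <;> fin_cases j <;>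
    simp only [of_apply, cons_val', cons_val_zero, cons_val_one, cons_val_fin_one, Fin.mk_one,
      Fin.zero_eta] <;> fun_prop

theorem pauli_smul (r : ℝ) (n : Fin 3 → ℝ) : pauli (r • n) = (r : ℂ) • pauli n := by
  ext i j
  fin_cases i <;> fin_cases j <;> simp [pauli] <;> ring

theorem pauli_mul_pauli (m n : Fin 3 → ℝ) :
    pauli m * pauli n = ((m ⬝ᵥ n : ℝ) : ℂ) • 1 + I • pauli (m ⨯₃ n) := by
  ext i j
  fin_cases i <;> fin_cases j <;>
    simp [pauli, vec3_dotProduct, cross_apply, Matrix.mul_apply, Fin.sum_univ_two] <;> ring_nf <;>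
    simp only [Complex.I_sq] <;> ring

theorem isHermitian_pauli (n : Fin 3 → ℝ) : (pauli n).IsHermitian := by
  ext i j
  fin_cases i <;> fin_cases j <;> simp [pauli, sub_eq_add_neg]

theorem isSymmetric_coinOp_pauli (n : Fin 3 → ℝ) :
    (coinOp (pauli n) : Coin →ₗ[ℂ] Coin).IsSymmetric := by
  rw [coe_toEuclideanCLM_eq_toEuclideanLin]
  exact Matrix.isSymmetric_toEuclideanLin_iff.2 (isHermitian_pauli n)

theorem coinOp_pauli_involutive {n : Fin 3 → ℝ} (hn : n ⬝ᵥ n = 1) (v : Coin) :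
    coinOp (pauli n) (coinOp (pauli n) v) = v := by
  have h : pauli n * pauli n = 1 := by
    rw [pauli_mul_pauli, hn, cross_self, ← zero_smul ℝ (0 : Fin 3 → ℝ), pauli_smul]
    simp
  rw [coinOp, ← mul_apply_eq_comp, ← map_mul, h, map_one, one_apply_eq_self]

theorem inner_coinOp_pauli (n : Fin 3 → ℝ) (α β : ℂ) :
    inner ℂ (!₂[α, β] : Coin) (coinOp (pauli n) !₂[α, β]) = (n ⬝ᵥ blochVector α β : ℝ) := by
  rw [coinOp, Matrix.toEuclideanCLM_toLp]
  simp only [pauli, blochVector, PiLp.inner_apply, RCLike.inner_apply, Fin.sum_univ_two,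
    vec3_dotProduct, Matrix.mulVec, Matrix.of_apply, Matrix.cons_val_zero, Matrix.cons_val_one,
    Complex.sq_norm, Complex.normSq_apply, vec2_dotProduct]
  apply Complex.ext <;> simp <;> ring

theorem norm_sq_coin (α β : ℂ) : ‖(!₂[α, β] : Coin)‖ ^ 2 = ‖α‖ ^ 2 + ‖β‖ ^ 2 := by
  rw [EuclideanSpace.norm_sq_eq, Fin.sum_univ_two]; rfl

end Pauli

section Dispersion

/-- The function `1 - a cos k` of the wave number `k`; the dispersion relation of the walk is a
function of it for `a = cos θ sin θ`. -/
def offset (a k : ℝ) : ℝ := 1 - a * Real.cos k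

/-- The square root `√((1 - a cos k)² - a²)`, the sine of the quasi-energy divided by `sin k`. -/
def gapRoot (a k : ℝ) : ℝ := √(offset a k ^ 2 - a ^ 2)

/-- The modulus of the group velocity at the wave number `k`. -/
def speed (a k : ℝ) : ℝ := (2 * offset a k - 1) / gapRoot a k

/-- The eigenvalue, of modulus one, of a step of the walk at the wave number `k` in the band `ε`.
The band is labelled by the sign of its group velocity `ε * speed a k`. -/
def band (a : ℝ) (ε : ℤˣ) (k : ℝ) : ℂ :=
  ((Real.cos k + a * Real.sin k ^ 2 : ℝ) : ℂ) - ((ε : ℤ) * (Real.sin k * gapRoot a k) : ℝ) * I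

variable {a : ℝ}

theorem offset_neg (a k : ℝ) : offset a (-k) = offset a k := by
  rw [offset, Real.cos_neg, offset]

theorem gapRoot_neg (a k : ℝ) : gapRoot a (-k) = gapRoot a k := by
  rw [gapRoot, offset_neg, gapRoot]

theorem speed_neg (a k : ℝ) : speed a (-k) = speed a k := by
  rw [speed, offset_neg, gapRoot_neg, speed]

theorem half_lt_offset (ha : |a| < 1 / 2) (k : ℝ) : 1 / 2 < offset a k := by
  have h : |a * Real.cos k| ≤ |a| := by
    rw [abs_mul]
    exact mul_le_of_le_one_right (abs_nonneg a) (Real.abs_cos_le_one k)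
  rw [offset]
  linarith [le_abs_self (a * Real.cos k)]

theorem sq_lt_quarter (ha : |a| < 1 / 2) : a ^ 2 < 1 / 4 := by
  have := sq_lt_sq' (by linarith [abs_nonneg a]) ha
  rw [sq_abs] at this
  linarith

theorem gapRoot_arg_pos (ha : |a| < 1 / 2) (k : ℝ) : 0 < offset a k ^ 2 - a ^ 2 := by
  nlinarith [half_lt_offset ha k, sq_lt_quarter ha]

theorem gapRoot_pos (ha : |a| < 1 / 2) (k : ℝ) : 0 < gapRoot a k :=
  Real.sqrt_pos.2 (gapRoot_arg_pos ha k)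

theorem gapRoot_sq (ha : |a| < 1 / 2) (k : ℝ) : gapRoot a k ^ 2 = offset a k ^ 2 - a ^ 2 :=
  Real.sq_sqrt (gapRoot_arg_pos ha k).le

theorem offset_sub_two_mul_sq_pos (ha : |a| < 1 / 2) (k : ℝ) : 0 < offset a k - 2 * a ^ 2 := by
  linarith [half_lt_offset ha k, sq_lt_quarter ha]

theorem four_sub_speed_sq (ha : |a| < 1 / 2) (k : ℝ) :
    4 - speed a k ^ 2 = (4 * offset a k - 1 - 4 * a ^ 2) / gapRoot a k ^ 2 := by
  have hg := (gapRoot_pos ha k).ne'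
  rw [speed]
  field_simp
  rw [gapRoot_sq ha]
  ring

theorem four_sub_speed_sq_pos (ha : |a| < 1 / 2) (k : ℝ) : 0 < 4 - speed a k ^ 2 := by
  rw [four_sub_speed_sq ha]
  exact div_pos (by linarith [half_lt_offset ha k, sq_lt_quarter ha])
    (pow_pos (gapRoot_pos ha k) 2)

theorem sqrt_one_sub_add_speed_sq (ha : |a| < 1 / 2) (k : ℝ) :
    √(1 - 4 * a ^ 2 + a ^ 2 * speed a k ^ 2) = (offset a k - 2 * a ^ 2) / gapRoot a k := by
  have hg := gapRoot_pos ha k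
  rw [Real.sqrt_eq_iff_mul_self_eq_of_pos (div_pos (offset_sub_two_mul_sq_pos ha k) hg), speed]
  field_simp
  rw [gapRoot_sq ha]
  ring

theorem offset_mul_four_sub_speed_sq (ha : |a| < 1 / 2) (k : ℝ) :
    offset a k * (4 - speed a k ^ 2)
      = 2 + speed a k * √(1 - 4 * a ^ 2 + a ^ 2 * speed a k ^ 2) := by
  have hg := (gapRoot_pos ha k).ne'
  rw [four_sub_speed_sq ha, sqrt_one_sub_add_speed_sq ha, speed]
  field_simp
  linear_combination -2 * gapRoot_sq ha k

theorem speed_zero (a : ℝ) : speed a 0 = √(1 - 2 * a) := by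
  have h₁ : 2 * (1 - a) - 1 = 1 - 2 * a := by ring
  have h₂ : (1 - a) ^ 2 - a ^ 2 = 1 - 2 * a := by ring
  rw [speed, gapRoot, offset, Real.cos_zero, mul_one, h₁, h₂, Real.div_sqrt]

theorem speed_pi (a : ℝ) : speed a Real.pi = √(1 + 2 * a) := by
  have h₁ : 2 * (1 + a) - 1 = 1 + 2 * a := by ring
  have h₂ : (1 + a) ^ 2 - a ^ 2 = 1 + 2 * a := by ring
  rw [speed, gapRoot, offset, Real.cos_pi, mul_neg_one, sub_neg_eq_add, h₁, h₂, Real.div_sqrt]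

theorem hasDerivAt_offset (a k : ℝ) : HasDerivAt (offset a) (a * Real.sin k) k :=
  (((Real.hasDerivAt_cos k).const_mul a).const_sub 1).congr_deriv (by ring)

theorem hasDerivAt_gapRoot (ha : |a| < 1 / 2) (k : ℝ) :
    HasDerivAt (gapRoot a) (offset a k * (a * Real.sin k) / gapRoot a k) k := by
  have h := (((hasDerivAt_offset a k).pow 2).sub_const (a ^ 2)).sqrt (gapRoot_arg_pos ha k).ne'
  refine h.congr_deriv ?_
  rw [Nat.cast_ofNat, mul_assoc, mul_div_mul_left _ _ two_ne_zero, pow_one]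
  rfl

theorem hasDerivAt_speed (ha : |a| < 1 / 2) (k : ℝ) :
    HasDerivAt (speed a)
      ((offset a k - 2 * a ^ 2) * (a * Real.sin k) / gapRoot a k ^ 3) k := by
  have hg := (gapRoot_pos ha k).ne'
  refine ((((hasDerivAt_offset a k).const_mul 2).sub_const 1).div (hasDerivAt_gapRoot ha k)
    hg).congr_deriv ?_
  field_simp
  rw [gapRoot_sq ha]
  ring

theorem continuous_offset (a : ℝ) : Continuous (offset a) := by
  unfold offset
  fun_prop

theorem continuous_gapRoot (a : ℝ) : Continuous (gapRoot a) :=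
  (((continuous_offset a).pow 2).sub continuous_const).sqrt

theorem continuous_speed (ha : |a| < 1 / 2) : Continuous (speed a) :=
  ((continuous_const.mul (continuous_offset a)).sub continuous_const).div (continuous_gapRoot a)
    fun k => (gapRoot_pos ha k).ne'

theorem strictMonoOn_speed (h0 : 0 < a) (ha : |a| < 1 / 2) :
    StrictMonoOn (speed a) (Set.Icc 0 Real.pi) := by
  refine strictMonoOn_of_deriv_pos (convex_Icc _ _) (continuous_speed ha).continuousOn
    fun k hk => ?_
  rw [interior_Icc] at hk
  rw [(hasDerivAt_speed ha k).deriv]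
  exact div_pos (mul_pos (offset_sub_two_mul_sq_pos ha k)
    (mul_pos h0 (Real.sin_pos_of_mem_Ioo hk))) (pow_pos (gapRoot_pos ha k) 3)

theorem strictAntiOn_speed (h0 : a < 0) (ha : |a| < 1 / 2) :
    StrictAntiOn (speed a) (Set.Icc 0 Real.pi) := by
  refine strictAntiOn_of_deriv_neg (convex_Icc _ _) (continuous_speed ha).continuousOn
    fun k hk => ?_
  rw [interior_Icc] at hk
  rw [(hasDerivAt_speed ha k).deriv]
  exact div_neg_of_neg_of_pos (mul_neg_of_pos_of_neg (offset_sub_two_mul_sq_pos ha k)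
    (mul_neg_of_neg_of_pos h0 (Real.sin_pos_of_mem_Ioo hk))) (pow_pos (gapRoot_pos ha k) 3)

theorem injOn_speed (h0 : a ≠ 0) (ha : |a| < 1 / 2) :
    Set.InjOn (speed a) (Set.Icc 0 Real.pi) := by
  rcases h0.lt_or_gt with h | h
  · exact (strictAntiOn_speed h ha).injOn
  · exact (strictMonoOn_speed h ha).injOn

theorem image_speed_Ioo (h0 : a ≠ 0) (ha : |a| < 1 / 2) :
    speed a '' Set.Ioo 0 Real.pi = Set.Ioo √(1 - 2 * |a|) √(1 + 2 * |a|) := by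
  have hc : ContinuousOn (speed a) (Set.Icc 0 Real.pi) := (continuous_speed ha).continuousOn
  rcases h0.lt_or_gt with h | h
  · rw [hc.image_Ioo_of_strictAntiOn Real.pi_pos.le (strictAntiOn_speed h ha), speed_zero, speed_pi,
      abs_of_neg h, mul_neg, sub_neg_eq_add, ← sub_eq_add_neg]
  · rw [hc.image_Ioo_of_strictMonoOn Real.pi_pos.le (strictMonoOn_speed h ha), speed_zero, speed_pi,
      abs_of_pos h]

theorem sq_cos_add_sq_sin_quasiEnergy (ha : |a| < 1 / 2) (k : ℝ) :
    (Real.cos k + a * Real.sin k ^ 2) ^ 2 + (Real.sin k * gapRoot a k) ^ 2 = 1 := by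
  rw [mul_pow, gapRoot_sq ha, Real.sin_sq, offset]
  ring

theorem norm_band (ha : |a| < 1 / 2) (ε : ℤˣ) (k : ℝ) : ‖band a ε k‖ = 1 := by
  have hε : ((ε : ℤ) : ℝ) ^ 2 = 1 := by rw [sq]; exact_mod_cast Int.units_coe_mul_self ε
  rw [← sq_eq_sq₀ (norm_nonneg _) zero_le_one, ← Complex.normSq_eq_norm_sq, band,
    sub_eq_add_neg, ← neg_mul, ← Complex.ofReal_neg, Complex.normSq_add_mul_I, neg_sq, mul_pow, hε,
    one_mul, sq_cos_add_sq_sin_quasiEnergy ha, one_pow]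

theorem hasDerivAt_re_band (ha : |a| < 1 / 2) (k : ℝ) :
    HasDerivAt (fun k => Real.cos k + a * Real.sin k ^ 2)
      (-(speed a k * (Real.sin k * gapRoot a k))) k := by
  have hg := (gapRoot_pos ha k).ne'
  refine ((Real.hasDerivAt_cos k).add
    (((Real.hasDerivAt_sin k).pow 2).const_mul a)).congr_deriv ?_
  rw [speed, offset, Nat.cast_ofNat]
  field_simp
  ring

theorem hasDerivAt_im_band (ha : |a| < 1 / 2) (k : ℝ) :
    HasDerivAt (fun k => Real.sin k * gapRoot a k)
      (speed a k * (Real.cos k + a * Real.sin k ^ 2)) k := by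
  have hg := (gapRoot_pos ha k).ne'
  refine ((Real.hasDerivAt_sin k).mul (hasDerivAt_gapRoot ha k)).congr_deriv ?_
  rw [speed]
  field_simp
  rw [gapRoot_sq ha, offset, Real.sin_sq]
  ring

theorem hasDerivAt_band (ha : |a| < 1 / 2) (ε : ℤˣ) (k : ℝ) :
    HasDerivAt (band a ε) (-(((ε : ℤ) * speed a k : ℝ) * I) * band a ε k) k := by
  have hε : ((ε : ℤ) : ℂ) ^ 2 = 1 := by rw [sq]; exact_mod_cast Int.units_coe_mul_self ε
  refine ((hasDerivAt_re_band ha k).ofReal_comp.sub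
    (((hasDerivAt_im_band ha k).const_mul ((ε : ℤ) : ℝ)).ofReal_comp.mul_const I)).congr_deriv ?_
  rw [band]
  push_cast
  linear_combination (speed a k * (Complex.sin k * gapRoot a k)) * hε
    - (ε : ℤ) ^ 2 * (speed a k * (Complex.sin k * gapRoot a k)) * Complex.I_sq

end Dispersion

section FourierSymbol

open Matrix

theorem wave_zero_right (k : ℝ) : wave k 0 = 1 := by simp [wave]

theorem wave_one (k : ℝ) : wave k 1 = Real.cos k - Real.sin k * I := by
  rw [wave, Int.cast_one, mul_one, ← Complex.ofReal_neg, Complex.exp_mul_I,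
    ← Complex.ofReal_cos, ← Complex.ofReal_sin, Real.cos_neg, Real.sin_neg]
  push_cast
  ring

theorem wave_neg_one (k : ℝ) : wave k (-1) = Real.cos k + Real.sin k * I := by
  simp [wave, Complex.exp_mul_I]

theorem hasSum_wave_shift {k : ℝ} {Ψ : State} {v : Coin}
    (h : HasSum (fun x : ℤ => wave k x • Ψ x) v) (d : ℤ) (M : Matrix (Fin 2) (Fin 2) ℂ) :
    HasSum (fun x : ℤ => wave k x • shift d M Ψ x) (coinOp (wave k d • M) v) := by
  have h₁ := (Equiv.subRight d).hasSum_iff.2 ((h.mapL (coinOp M)).const_smul (wave k d))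
  rw [coinOp, map_smul, _root_.smul_apply]
  refine h₁.congr_fun fun x => ?_
  simp only [Function.comp_apply, Equiv.subRight_apply, map_smul, smul_smul]
  rw [← wave_add, add_sub_cancel]
  rfl

/-- The Fourier symbol of `U₁` is the reflection `axis₁ θ k · σ` of the coin space. -/
def axis₁ (θ k : ℝ) : Fin 3 → ℝ :=
  ![Real.sin θ, -(Real.cos θ * Real.sin k), Real.cos θ * Real.cos k]

/-- The Fourier symbol of `U₂` is the reflection `axis₂ θ k · σ` of the coin space. -/
def axis₂ (θ k : ℝ) : Fin 3 → ℝ :=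
  ![Real.sin θ * Real.cos k, -(Real.sin θ * Real.sin k), Real.cos θ]

theorem hasSum_wave_shift_add_shift_add_shift {k : ℝ} {Ψ : State} {v : Coin}
    (h : HasSum (fun x : ℤ => wave k x • Ψ x) v) (L M N : Matrix (Fin 2) (Fin 2) ℂ) :
    HasSum (fun x : ℤ => wave k x • (shift (-1) L + shift 0 M + shift 1 N) Ψ x)
      (coinOp (wave k (-1) • L + wave k 0 • M + wave k 1 • N) v) := by
  have hsum := ((hasSum_wave_shift h (-1) L).add (hasSum_wave_shift h 0 M)).add
    (hasSum_wave_shift h 1 N)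
  simp only [← smul_add, coinOp, ← _root_.add_apply, ← map_add] at hsum
  exact hsum

theorem hasSum_wave_U₁ {θ k : ℝ} {Ψ : State} {v : Coin}
    (h : HasSum (fun x : ℤ => wave k x • Ψ x) v) :
    HasSum (fun x : ℤ => wave k x • U₁ θ Ψ x) (coinOp (pauli (axis₁ θ k)) v) := by
  have hM : pauli (axis₁ θ k) = wave k (-1) • (((Real.cos θ / 2 : ℝ) : ℂ) • !![1, 1; -1, -1])
      + wave k 0 • (((Real.sin θ : ℝ) : ℂ) • !![0, 1; 1, 0])
      + wave k 1 • (((Real.cos θ / 2 : ℝ) : ℂ) • !![1, -1; 1, -1]) := by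
    rw [wave_one, wave_neg_one, wave_zero_right]
    ext i j
    fin_cases i <;> fin_cases j <;> simp [pauli, axis₁] <;> ring
  rw [hM]
  exact hasSum_wave_shift_add_shift_add_shift h _ _ _

theorem hasSum_wave_U₂ {θ k : ℝ} {Ψ : State} {v : Coin}
    (h : HasSum (fun x : ℤ => wave k x • Ψ x) v) :
    HasSum (fun x : ℤ => wave k x • U₂ θ Ψ x) (coinOp (pauli (axis₂ θ k)) v) := by
  have hM : pauli (axis₂ θ k) = wave k (-1) • (((Real.sin θ : ℝ) : ℂ) • !![0, 1; 0, 0])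
      + wave k 0 • (((Real.cos θ : ℝ) : ℂ) • !![1, 0; 0, -1])
      + wave k 1 • (((Real.sin θ : ℝ) : ℂ) • !![0, 0; 1, 0]) := by
    rw [wave_one, wave_neg_one, wave_zero_right]
    ext i j
    fin_cases i <;> fin_cases j <;> simp [pauli, axis₂] <;> ring
  rw [hM]
  exact hasSum_wave_shift_add_shift_add_shift h _ _ _

theorem support_shift_finite {Ψ : State} (h : (Ψ : ℤ → Coin).support.Finite) (d : ℤ)
    (M : Matrix (Fin 2) (Fin 2) ℂ) : (shift d M Ψ : ℤ → Coin).support.Finite := by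
  refine (h.preimage (sub_left_injective (b := d)).injOn).subset fun x hx hΨ => hx ?_
  change coinOp M (Ψ (x - d)) = 0
  rw [hΨ, map_zero]

theorem support_shift_add_shift_add_shift_finite {Ψ : State}
    (h : (Ψ : ℤ → Coin).support.Finite) (L M N : Matrix (Fin 2) (Fin 2) ℂ) :
    ((shift (-1) L + shift 0 M + shift 1 N) Ψ : ℤ → Coin).support.Finite :=
  (((support_shift_finite h (-1) L).union (support_shift_finite h 0 M)).subset
    (Function.support_add _ _)).union (support_shift_finite h 1 N) |>.subset
    (Function.support_add _ _)

theorem support_walk_finite (θ : ℝ) (α β : ℂ) (t : ℕ) :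
    (walk θ α β t : ℤ → Coin).support.Finite := by
  induction t with
  | zero =>
    refine (Set.finite_singleton 0).subset fun x hx => ?_
    by_contra h
    exact hx (lp.single_apply_ne 2 0 _ h)
  | succ t ih =>
    exact support_shift_add_shift_add_shift_finite
      (support_shift_add_shift_add_shift_finite ih _ _ _) _ _ _

end FourierSymbol

section Bands

open Matrix

/-- The product `cos θ sin θ`. -/
def coupling (θ : ℝ) : ℝ := Real.cos θ * Real.sin θ

/-- The unit vector `n` such that the Fourier symbol of a step of the walk is a function of the
reflection `n · σ`, which is `1` on the band `1` and `-1` on the band `-1`. -/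
def blochAxis (θ k : ℝ) : Fin 3 → ℝ :=
  (gapRoot (coupling θ) k)⁻¹ • ![Real.sin θ ^ 2 - offset (coupling θ) k,
    -(coupling θ * Real.sin k), Real.cos θ ^ 2 - offset (coupling θ) k]

/-- The component of the initial coin state along the band `ε` at the wave number `k`. -/
def component (θ : ℝ) (α β : ℂ) (ε : ℤˣ) (k : ℝ) : Coin :=
  reflectionPart (coinOp (pauli (blochAxis θ k))) ε !₂[α, β]

variable {θ : ℝ}

theorem four_mul_coupling_sq (θ : ℝ) :
    4 * coupling θ ^ 2 = 1 - (2 * Real.cos θ ^ 2 - 1) ^ 2 := by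
  rw [coupling, mul_pow, Real.sin_sq]
  ring

theorem axis₂_dotProduct_axis₁ (θ k : ℝ) :
    axis₂ θ k ⬝ᵥ axis₁ θ k = Real.cos k + coupling θ * Real.sin k ^ 2 := by
  simp only [axis₂, axis₁, vec3_dotProduct, Matrix.cons_val, coupling]
  linear_combination Real.cos k * Real.sin_sq_add_cos_sq θ

theorem axis₂_cross_axis₁ (ha : |coupling θ| < 1 / 2) (k : ℝ) :
    axis₂ θ k ⨯₃ axis₁ θ k
      = (-(Real.sin k * gapRoot (coupling θ) k)) • blochAxis θ k := by
  have hg := (gapRoot_pos ha k).ne'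
  rw [blochAxis, smul_smul, neg_mul, mul_inv_cancel_right₀ hg]
  ext i
  fin_cases i <;> simp [axis₁, axis₂, cross_apply, offset, coupling]
  · linear_combination Real.sin k * Real.sin_sq_add_cos_sq θ
  · linear_combination -(Real.cos θ * Real.sin θ) * Real.sin_sq_add_cos_sq k
  · linear_combination Real.sin k * Real.sin_sq_add_cos_sq θ

theorem pauli_axis₂_mul_pauli_axis₁ (ha : |coupling θ| < 1 / 2) (k : ℝ) :
    pauli (axis₂ θ k) * pauli (axis₁ θ k)
      = ((Real.cos k + coupling θ * Real.sin k ^ 2 : ℝ) : ℂ) • 1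
        - (((Real.sin k * gapRoot (coupling θ) k : ℝ) : ℂ) * I) • pauli (blochAxis θ k) := by
  rw [pauli_mul_pauli, axis₂_dotProduct_axis₁, axis₂_cross_axis₁ ha, pauli_smul, smul_smul,
    Complex.ofReal_neg, mul_neg, neg_smul, ← sub_eq_add_neg, mul_comm I]

theorem blochAxis_dotProduct_self (ha : |coupling θ| < 1 / 2) (k : ℝ) :
    blochAxis θ k ⬝ᵥ blochAxis θ k = 1 := by
  have hg := (gapRoot_pos ha k).ne'
  simp only [blochAxis, dotProduct_smul, smul_dotProduct, vec3_dotProduct, Matrix.cons_val,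
    smul_eq_mul]
  field_simp
  rw [gapRoot_sq ha, Real.sin_sq θ, Real.sin_sq k, offset]
  linear_combination (1 / 2 : ℝ) * four_mul_coupling_sq θ

theorem coinOp_axis₂_component (ha : |coupling θ| < 1 / 2) (α β : ℂ) (ε : ℤˣ) (k : ℝ) :
    coinOp (pauli (axis₂ θ k)) (coinOp (pauli (axis₁ θ k)) (component θ α β ε k))
      = band (coupling θ) ε k • component θ α β ε k := by
  have h := apply_reflectionPart
    (coinOp_pauli_involutive (blochAxis_dotProduct_self ha k) !₂[α, β]) ε
  rw [coinOp, ← mul_apply_eq_comp, ← map_mul, pauli_axis₂_mul_pauli_axis₁ ha, map_sub, map_smul,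
    map_smul, map_one, _root_.sub_apply, _root_.smul_apply, _root_.smul_apply, one_apply_eq_self,
    component, h, band, sub_smul, ← Int.cast_smul_eq_zsmul ℂ, smul_smul]
  push_cast
  ring_nf

theorem hasSum_wave_walk (ha : |coupling θ| < 1 / 2) (α β : ℂ) (t : ℕ) (k : ℝ) :
    HasSum (fun x : ℤ => wave k x • walk θ α β t x)
      (∑ ε, band (coupling θ) ε k ^ t • component θ α β ε k) := by
  induction t with
  | zero =>
    have h := hasSum_single (f := fun x : ℤ => wave k x • walk θ α β 0 x) 0 fun x hx => by
      rw [walk, lp.single_apply_ne 2 0 _ hx, smul_zero]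
    simp only [pow_zero, one_smul, component, sum_reflectionPart]
    rwa [wave_zero_right, one_smul, walk, lp.single_apply_self] at h
  | succ t ih =>
    have h := hasSum_wave_U₂ (θ := θ) (hasSum_wave_U₁ (θ := θ) ih)
    simp only [map_sum, map_smul, coinOp_axis₂_component ha, smul_smul, ← pow_succ] at h
    exact h

theorem continuous_component (ha : |coupling θ| < 1 / 2) (α β : ℂ) (ε : ℤˣ) :
    Continuous (component θ α β ε) := by
  have hg : Continuous fun k => (gapRoot (coupling θ) k)⁻¹ :=
    (continuous_gapRoot _).inv₀ fun k => (gapRoot_pos ha k).ne'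
  have hw := continuous_offset (coupling θ)
  have hn : Continuous (blochAxis θ) := by
    unfold blochAxis
    refine hg.smul (continuous_pi fun i => ?_)
    fin_cases i <;> simp only [cons_val, Fin.mk_one, Fin.zero_eta, Fin.reduceFinMk] <;> fun_prop
  unfold component reflectionPart
  simp only [coinOp, Matrix.toEuclideanCLM_toLp]
  fun_prop

theorem isBandSystem (ha : |coupling θ| < 1 / 2) (α β : ℂ) :
    IsBandSystem (band (coupling θ)) (fun ε k => (ε : ℤ) * speed (coupling θ) k)
      (component θ α β) where
  norm_eq_one := norm_band ha
  hasDerivAt := hasDerivAt_band ha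
  continuous_component := continuous_component ha α β
  inner_eq_zero k _ _ h := inner_reflectionPart_of_ne (isSymmetric_coinOp_pauli _)
    (coinOp_pauli_involutive (blochAxis_dotProduct_self ha k) _) h

theorem norm_sq_component (ha : |coupling θ| < 1 / 2) {α β : ℂ} (hαβ : ‖α‖ ^ 2 + ‖β‖ ^ 2 = 1)
    (ε : ℤˣ) (k : ℝ) :
    ‖component θ α β ε k‖ ^ 2 = (1 + (ε : ℤ) * (blochAxis θ k ⬝ᵥ blochVector α β)) / 2 := by
  rw [component, norm_sq_reflectionPart (isSymmetric_coinOp_pauli _)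
    (coinOp_pauli_involutive (blochAxis_dotProduct_self ha k) _), inner_coinOp_pauli,
    norm_sq_coin, hαβ, RCLike.re_to_complex, Complex.ofReal_re]

theorem isProbabilityMeasure_positionLaw (ha : |coupling θ| < 1 / 2) {α β : ℂ}
    (hαβ : ‖α‖ ^ 2 + ‖β‖ ^ 2 = 1) (t : ℕ) : IsProbabilityMeasure (positionLaw θ α β t) := by
  refine isProbabilityMeasure_bornLaw (support_walk_finite θ α β t)
    (hasSum_wave_walk ha α β t) fun k => ?_
  rw [(isBandSystem ha α β).norm_sum_pow_smul]
  simp only [component, sum_reflectionPart]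
  rw [← sq_eq_sq₀ (norm_nonneg _) zero_le_one, norm_sq_coin, hαβ, one_pow]

/-- The mean of the Bloch axis in the initial state, up to sign, symmetrized in `k`. -/
def bias (θ : ℝ) (α β : ℂ) (k : ℝ) : ℝ :=
  ((offset (coupling θ) k - Real.cos θ ^ 2) * (‖α‖ ^ 2 - ‖β‖ ^ 2)
    + (offset (coupling θ) k - Real.sin θ ^ 2) * (α * star β + star α * β).re)
    / gapRoot (coupling θ) k

theorem continuous_bias (ha : |coupling θ| < 1 / 2) (α β : ℂ) : Continuous (bias θ α β) := by
  have hg := continuous_gapRoot (coupling θ)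
  have hw := continuous_offset (coupling θ)
  unfold bias
  exact Continuous.div (by fun_prop) hg fun k => (gapRoot_pos ha k).ne'

theorem norm_sq_component_add_norm_sq_component_neg (ha : |coupling θ| < 1 / 2) {α β : ℂ}
    (hαβ : ‖α‖ ^ 2 + ‖β‖ ^ 2 = 1) (ε : ℤˣ) (k : ℝ) :
    ‖component θ α β ε k‖ ^ 2 + ‖component θ α β ε (-k)‖ ^ 2 = 1 - (ε : ℤ) * bias θ α β k := by
  rw [norm_sq_component ha hαβ, norm_sq_component ha hαβ, blochAxis, blochAxis, offset_neg,
    gapRoot_neg, Real.sin_neg, bias]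
  simp only [blochVector, smul_dotProduct, vec3_dotProduct, Matrix.cons_val, smul_eq_mul]
  ring

theorem int_units_mul_bias_le_one (ha : |coupling θ| < 1 / 2) {α β : ℂ}
    (hαβ : ‖α‖ ^ 2 + ‖β‖ ^ 2 = 1) (ε : ℤˣ) (k : ℝ) : (ε : ℤ) * bias θ α β k ≤ 1 := by
  rw [← sub_nonneg, ← norm_sq_component_add_norm_sq_component_neg ha hαβ]
  positivity

end Bands

section Density

variable {θ : ℝ} {α β : ℂ}

theorem cs_eq_abs_coupling (hs : 0 < Real.sin θ) : cs θ = |coupling θ| := by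
  rw [cs, coupling, abs_mul, abs_of_pos hs]

theorem image_speed_Ioo_eq_Ioo_edges (hs : 0 < Real.sin θ) (h0 : coupling θ ≠ 0)
    (ha : |coupling θ| < 1 / 2) :
    speed (coupling θ) '' Set.Ioo 0 Real.pi = Set.Ioo (innerEdge θ) (outerEdge θ) := by
  rw [image_speed_Ioo h0 ha, innerEdge, outerEdge, cs_eq_abs_coupling hs]

theorem D_eq (θ x : ℝ) : D θ x = 1 - 4 * coupling θ ^ 2 + coupling θ ^ 2 * x ^ 2 := by
  rw [D, coupling]
  ring

theorem sqrt_D_speed (ha : |coupling θ| < 1 / 2) (k : ℝ) :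
    √(D θ (speed (coupling θ) k))
      = (offset (coupling θ) k - 2 * coupling θ ^ 2) / gapRoot (coupling θ) k := by
  rw [D_eq, sqrt_one_sub_add_speed_sq ha]

theorem two_mul_cos_sq_sub_one_ne_zero (ha : |coupling θ| < 1 / 2) :
    2 * Real.cos θ ^ 2 - 1 ≠ 0 := by
  intro h
  have h4 := four_mul_coupling_sq θ
  rw [h] at h4
  linarith [sq_lt_quarter ha]

theorem nu_one_speed (ha : |coupling θ| < 1 / 2) (α β : ℂ) (k : ℝ) :
    nu 1 θ α β (speed (coupling θ) k) = bias θ α β k := by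
  have hc := two_mul_cos_sq_sub_one_ne_zero ha
  have hg := (gapRoot_pos ha k).ne'
  rw [nu, sqrt_D_speed ha, bias, speed, Real.sin_sq]
  field_simp
  generalize (α * star β + star α * β).re = R
  linear_combination (‖α‖ ^ 2 - ‖β‖ ^ 2 - R) / 2 * four_mul_coupling_sq θ

theorem Wplus_speed (hs : 0 < Real.sin θ) (ha : |coupling θ| < 1 / 2) (k : ℝ) :
    Wplus θ (speed (coupling θ) k)
      = (4 - speed (coupling θ) k ^ 2) * (|coupling θ| - coupling θ * Real.cos k) := by
  have h := offset_mul_four_sub_speed_sq ha k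
  rw [offset] at h
  rw [Wplus, D_eq, cs_eq_abs_coupling hs]
  linear_combination -h

theorem Wminus_speed (hs : 0 < Real.sin θ) (ha : |coupling θ| < 1 / 2) (k : ℝ) :
    Wminus θ (speed (coupling θ) k)
      = (4 - speed (coupling θ) k ^ 2) * (|coupling θ| + coupling θ * Real.cos k) := by
  have h := offset_mul_four_sub_speed_sq ha k
  rw [offset] at h
  rw [Wminus, D_eq, cs_eq_abs_coupling hs]
  linear_combination h

theorem sqrt_Wplus_mul_sqrt_Wminus_speed (hs : 0 < Real.sin θ) (ha : |coupling θ| < 1 / 2) {k : ℝ}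
    (hk : k ∈ Set.Ioo 0 Real.pi) :
    √(Wplus θ (speed (coupling θ) k)) * √(Wminus θ (speed (coupling θ) k))
      = (4 - speed (coupling θ) k ^ 2) * (|coupling θ| * Real.sin k) := by
  have hF := four_sub_speed_sq_pos ha k
  have hk := Real.sin_pos_of_mem_Ioo hk
  have hcos : coupling θ * Real.cos k ≤ |coupling θ| := (le_abs_self _).trans <| by
    rw [abs_mul]
    exact mul_le_of_le_one_right (abs_nonneg _) (Real.abs_cos_le_one k)
  rw [Wplus_speed hs ha, Wminus_speed hs ha,
    ← Real.sqrt_mul (mul_nonneg hF.le (sub_nonneg.2 hcos)),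
    ← Real.sqrt_sq (mul_nonneg hF.le (mul_nonneg (abs_nonneg _) hk.le))]
  congr 1
  linear_combination (4 - speed (coupling θ) k ^ 2) ^ 2
    * (Real.cos k ^ 2 * sq_abs (coupling θ) - |coupling θ| ^ 2 * Real.sin_sq_add_cos_sq k)

theorem abs_deriv_speed_mul_f_speed (hs : 0 < Real.sin θ) (h0 : coupling θ ≠ 0)
    (ha : |coupling θ| < 1 / 2) {k : ℝ} (hk : k ∈ Set.Ioo 0 Real.pi) :
    |deriv (speed (coupling θ)) k| * f θ (speed (coupling θ) k) = (2 * Real.pi)⁻¹ := by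
  have hg := gapRoot_pos ha k
  have hD := offset_sub_two_mul_sq_pos ha k
  have hF := four_sub_speed_sq_pos ha k
  have hW := sqrt_Wplus_mul_sqrt_Wminus_speed hs ha hk
  have hk := Real.sin_pos_of_mem_Ioo hk
  have hsum : speed (coupling θ) k + 2 * √(D θ (speed (coupling θ) k))
      = (4 - speed (coupling θ) k ^ 2) * gapRoot (coupling θ) k := by
    rw [sqrt_D_speed ha, four_sub_speed_sq ha, speed]
    field_simp
    ring
  rw [(hasDerivAt_speed ha k).deriv, f, mul_assoc _ √(Wplus _ _), hW, hsum, sqrt_D_speed ha,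
    abs_div, abs_mul, abs_mul, abs_of_pos hD, abs_of_pos hk, abs_of_pos (pow_pos hg 3)]
  generalize 4 - speed (coupling θ) k ^ 2 = F at hF ⊢
  field_simp

/-- The part of the limit density carried by the band `ε`, as a function of the speed. -/
def branch (θ : ℝ) (α β : ℂ) (ε : ℤˣ) (x : ℝ) : ℝ :=
  f θ x * (1 - (ε : ℤ) * nu 1 θ α β x) * (Set.Ioo (innerEdge θ) (outerEdge θ)).indicator 1 x

theorem nu_neg_one (θ : ℝ) (α β : ℂ) (x : ℝ) : nu (-1) θ α β x = -nu 1 θ α β (-x) := by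
  simp only [nu, D, neg_sq]
  ring

theorem density_eq_sum_branch (θ : ℝ) (α β : ℂ) (x : ℝ) :
    density θ α β x = ∑ ε : ℤˣ, branch θ α β ε ((ε : ℤ) * x) := by
  rw [UnitsInt.univ, Finset.sum_pair (by decide), density, nu_neg_one]
  simp only [branch, Units.val_neg, Units.val_one, Int.cast_neg, Int.cast_one, one_mul, neg_mul,
    sub_neg_eq_add]

theorem measurable_density (θ : ℝ) (α β : ℂ) : Measurable (density θ α β) := by
  have h : Measurable ((Set.Ioo (innerEdge θ) (outerEdge θ)).indicator (1 : ℝ → ℝ)) :=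
    measurable_one.indicator measurableSet_Ioo
  unfold density f nu Wplus Wminus D
  fun_prop

theorem branch_eq_zero {ε : ℤˣ} {x : ℝ} (hx : x ∉ Set.Ioo (innerEdge θ) (outerEdge θ)) :
    branch θ α β ε x = 0 := by
  rw [branch, Set.indicator_of_notMem hx, mul_zero]

theorem density_eq_zero {x : ℝ} (h : x ∉ Set.Ioo (innerEdge θ) (outerEdge θ))
    (h' : -x ∉ Set.Ioo (innerEdge θ) (outerEdge θ)) : density θ α β x = 0 := by
  rw [density, Set.indicator_of_notMem h, Set.indicator_of_notMem h', mul_zero, mul_zero, add_zero]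

theorem support_density_subset (θ : ℝ) (α β : ℂ) :
    Function.support (density θ α β) ⊆
      Set.Ioo (-outerEdge θ) (-innerEdge θ) ∪ Set.Ioo (innerEdge θ) (outerEdge θ) := by
  refine Function.support_subset_iff'.2 fun x hx => ?_
  rw [Set.mem_union, not_or, ← Set.neg_Ioo, Set.mem_neg] at hx
  exact density_eq_zero hx.2 hx.1

theorem f_speed_nonneg (ha : |coupling θ| < 1 / 2) (k : ℝ) : 0 ≤ f θ (speed (coupling θ) k) := by
  have := four_sub_speed_sq_pos ha k
  rw [f]
  positivity

theorem branch_nonneg (hs : 0 < Real.sin θ) (h0 : coupling θ ≠ 0) (ha : |coupling θ| < 1 / 2)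
    (hαβ : ‖α‖ ^ 2 + ‖β‖ ^ 2 = 1) (ε : ℤˣ) (x : ℝ) : 0 ≤ branch θ α β ε x := by
  by_cases hx : x ∈ Set.Ioo (innerEdge θ) (outerEdge θ)
  · rw [branch, Set.indicator_of_mem hx, Pi.one_apply, mul_one]
    obtain ⟨k, -, rfl⟩ := (image_speed_Ioo_eq_Ioo_edges hs h0 ha).symm.subset hx
    rw [nu_one_speed ha]
    exact mul_nonneg (f_speed_nonneg ha k) (sub_nonneg.2 (int_units_mul_bias_le_one ha hαβ ε k))
  · rw [branch_eq_zero hx]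

theorem density_nonneg (hs : 0 < Real.sin θ) (h0 : coupling θ ≠ 0) (ha : |coupling θ| < 1 / 2)
    (hαβ : ‖α‖ ^ 2 + ‖β‖ ^ 2 = 1) (x : ℝ) : 0 ≤ density θ α β x := by
  rw [density_eq_sum_branch]
  exact Finset.sum_nonneg fun ε _ => branch_nonneg hs h0 ha hαβ ε _

section Integral

variable {E : Type*} [NormedAddCommGroup E] [NormedSpace ℝ E]

theorem abs_deriv_speed_smul_branch_smul (hs : 0 < Real.sin θ) (h0 : coupling θ ≠ 0)
    (ha : |coupling θ| < 1 / 2) (α β : ℂ) (ε : ℤˣ) (G : ℝ → E) {k : ℝ}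
    (hk : k ∈ Set.Ioo 0 Real.pi) :
    |deriv (speed (coupling θ)) k|
        • branch θ α β ε (speed (coupling θ) k) • G (speed (coupling θ) k)
      = ((2 * Real.pi)⁻¹ * (1 - (ε : ℤ) * bias θ α β k)) • G (speed (coupling θ) k) := by
  have hmem := (image_speed_Ioo_eq_Ioo_edges hs h0 ha).subset (Set.mem_image_of_mem _ hk)
  rw [branch, Set.indicator_of_mem hmem, nu_one_speed ha, smul_smul,
    ← abs_deriv_speed_mul_f_speed hs h0 ha hk, Pi.one_apply, mul_one, mul_assoc]

theorem hasDerivWithinAt_speed (ha : |coupling θ| < 1 / 2) (s : Set ℝ) (k : ℝ) :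
    HasDerivWithinAt (speed (coupling θ)) (deriv (speed (coupling θ)) k) s k :=
  (hasDerivAt_speed ha k).differentiableAt.hasDerivAt.hasDerivWithinAt

theorem integrable_branch_smul (hs : 0 < Real.sin θ) (h0 : coupling θ ≠ 0)
    (ha : |coupling θ| < 1 / 2) (α β : ℂ) (ε : ℤˣ) {G : ℝ → E} (hG : Continuous G) :
    Integrable fun x => branch θ α β ε x • G x := by
  have hv := continuous_speed ha
  have hb := continuous_bias ha α β
  have hon : IntegrableOn (fun x => branch θ α β ε x • G x)
      (Set.Ioo (innerEdge θ) (outerEdge θ)) := by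
    rw [← image_speed_Ioo_eq_Ioo_edges hs h0 ha, integrableOn_image_iff_integrableOn_abs_deriv_smul
      measurableSet_Ioo (fun k _ => hasDerivWithinAt_speed ha _ k)
      ((injOn_speed h0 ha).mono Set.Ioo_subset_Icc_self)]
    refine IntegrableOn.congr_fun ?_
      (fun k hk => (abs_deriv_speed_smul_branch_smul hs h0 ha α β ε G hk).symm) measurableSet_Ioo
    refine (Continuous.integrableOn_Icc ?_).mono_set Set.Ioo_subset_Icc_self
    fun_prop
  refine (integrableOn_iff_integrable_of_support_subset ?_).1 hon
  exact Function.support_subset_iff'.2 fun x hx => by rw [branch_eq_zero hx, zero_smul]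

theorem integral_branch_smul (hs : 0 < Real.sin θ) (h0 : coupling θ ≠ 0)
    (ha : |coupling θ| < 1 / 2) (α β : ℂ) (ε : ℤˣ) (G : ℝ → E) :
    ∫ x, branch θ α β ε x • G x
      = ∫ k in (0)..Real.pi,
          ((2 * Real.pi)⁻¹ * (1 - (ε : ℤ) * bias θ α β k)) • G (speed (coupling θ) k) := by
  rw [← setIntegral_eq_integral_of_forall_compl_eq_zero
      (s := Set.Ioo (innerEdge θ) (outerEdge θ)) fun x hx => by rw [branch_eq_zero hx, zero_smul],
    ← image_speed_Ioo_eq_Ioo_edges hs h0 ha, integral_image_eq_integral_abs_deriv_smul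
      measurableSet_Ioo (fun k _ => hasDerivWithinAt_speed ha _ k)
      ((injOn_speed h0 ha).mono Set.Ioo_subset_Icc_self),
    intervalIntegral.integral_of_le Real.pi_pos.le, integral_Ioc_eq_integral_Ioo]
  exact setIntegral_congr_fun measurableSet_Ioo
    fun k hk => abs_deriv_speed_smul_branch_smul hs h0 ha α β ε G hk

theorem integral_comp_int_units_mul (g : ℝ → E) (ε : ℤˣ) :
    ∫ x, g ((ε : ℤ) * x) = ∫ x, g x := by
  rw [Measure.integral_comp_mul_left, abs_inv, ← Int.cast_abs, Int.isUnit_iff_abs_eq.1 ε.isUnit,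
    Int.cast_one, inv_one, one_smul]

theorem density_smul_eq_sum (θ : ℝ) (α β : ℂ) (G : ℝ → E) (x : ℝ) :
    density θ α β x • G x
      = ∑ ε : ℤˣ, branch θ α β ε ((ε : ℤ) * x) • G ((ε : ℤ) * ((ε : ℤ) * x)) := by
  have hε (ε : ℤˣ) : (ε : ℤ) * ((ε : ℤ) * x) = x := by
    rw [← mul_assoc, ← Int.cast_mul, Int.units_coe_mul_self, Int.cast_one, one_mul]
  simp only [hε, ← Finset.sum_smul, ← density_eq_sum_branch]

theorem integrable_branch_int_units_mul_smul (hs : 0 < Real.sin θ) (h0 : coupling θ ≠ 0)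
    (ha : |coupling θ| < 1 / 2) (α β : ℂ) (ε : ℤˣ) {G : ℝ → E} (hG : Continuous G) :
    Integrable fun x => branch θ α β ε ((ε : ℤ) * x) • G ((ε : ℤ) * ((ε : ℤ) * x)) :=
  (integrable_branch_smul hs h0 ha α β ε (hG.comp (continuous_const_mul _))).comp_mul_left'
    (by exact_mod_cast ε.ne_zero)

theorem integrable_density_smul (hs : 0 < Real.sin θ) (h0 : coupling θ ≠ 0)
    (ha : |coupling θ| < 1 / 2) (α β : ℂ) {G : ℝ → E} (hG : Continuous G) :
    Integrable fun x => density θ α β x • G x := by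
  simp only [density_smul_eq_sum]
  exact integrable_finsetSum _ fun ε _ => integrable_branch_int_units_mul_smul hs h0 ha α β ε hG

theorem integral_density_smul (hs : 0 < Real.sin θ) (h0 : coupling θ ≠ 0)
    (ha : |coupling θ| < 1 / 2) (α β : ℂ) {G : ℝ → E} (hG : Continuous G) :
    ∫ x, density θ α β x • G x
      = ∑ ε : ℤˣ, ∫ k in (0)..Real.pi,
          ((2 * Real.pi)⁻¹ * (1 - (ε : ℤ) * bias θ α β k))
            • G ((ε : ℤ) * speed (coupling θ) k) := by
  simp only [density_smul_eq_sum]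
  rw [integral_finsetSum _ fun ε _ => integrable_branch_int_units_mul_smul hs h0 ha α β ε hG]
  refine Finset.sum_congr rfl fun ε _ => ?_
  exact (integral_comp_int_units_mul (fun x => branch θ α β ε x • G ((ε : ℤ) * x)) ε).trans
    (integral_branch_smul hs h0 ha α β ε _)

end Integral

theorem integrable_density (hs : 0 < Real.sin θ) (h0 : coupling θ ≠ 0)
    (ha : |coupling θ| < 1 / 2) (α β : ℂ) : Integrable (density θ α β) := by
  simpa only [smul_eq_mul, mul_one] using
    integrable_density_smul hs h0 ha α β (G := fun _ => (1 : ℝ)) continuous_const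

theorem integral_density (hs : 0 < Real.sin θ) (h0 : coupling θ ≠ 0)
    (ha : |coupling θ| < 1 / 2) (α β : ℂ) : ∫ x, density θ α β x = 1 := by
  have h := integral_density_smul hs h0 ha α β (G := fun _ => (1 : ℝ)) continuous_const
  have hb := continuous_bias ha α β
  have hsum (k : ℝ) :
      ∑ ε : ℤˣ, (2 * Real.pi)⁻¹ * (1 - (ε : ℤ) * bias θ α β k) = Real.pi⁻¹ := by
    rw [UnitsInt.univ, Finset.sum_pair (by decide)]
    simp only [Units.val_neg, Units.val_one, Int.cast_neg, Int.cast_one]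
    field_simp
    ring
  simp only [smul_eq_mul, mul_one] at h
  rw [h, ← intervalIntegral.integral_finsetSum
    fun ε _ => Continuous.intervalIntegrable (by fun_prop) _ _]
  simp only [hsum, intervalIntegral.integral_const, sub_zero, smul_eq_mul,
    mul_inv_cancel₀ Real.pi_ne_zero]

end Density

section Convergence

theorem cos_two_mul_ne_zero {θ : ℝ} (hθ : θ ∈ Set.Ioo 0 Real.pi) (hθ₁ : θ ≠ Real.pi / 4)
    (hθ₃ : θ ≠ 3 * Real.pi / 4) : Real.cos (2 * θ) ≠ 0 := by
  intro h
  obtain ⟨n, hn⟩ := Real.cos_eq_zero_iff.1 h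
  have hn₀ : ((-1 : ℤ) : ℝ) < n := by
    by_contra! hn'
    push_cast at hn'
    nlinarith [hθ.1, Real.pi_pos]
  have hn₂ : (n : ℝ) < (2 : ℤ) := by
    by_contra! hn'
    push_cast at hn'
    nlinarith [hθ.2, Real.pi_pos]
  rw [Int.cast_lt] at hn₀ hn₂
  obtain rfl | rfl : n = 0 ∨ n = 1 := by lia
  · exact hθ₁ (by push_cast at hn; linarith)
  · exact hθ₃ (by push_cast at hn; linarith)

theorem abs_coupling_lt_half {θ : ℝ} (h : Real.cos (2 * θ) ≠ 0) : |coupling θ| < 1 / 2 := by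
  rw [← abs_of_pos (one_half_pos (α := ℝ)), ← sq_lt_sq]
  have hc := sq_pos_of_ne_zero h
  rw [Real.cos_two_mul] at hc
  linarith [four_mul_coupling_sq θ]

theorem coupling_ne_zero {θ : ℝ} (hθ : θ ∈ Set.Ioo 0 Real.pi) (hθ₂ : θ ≠ Real.pi / 2) :
    coupling θ ≠ 0 := by
  refine mul_ne_zero (fun h => hθ₂ ?_) (Real.sin_pos_of_mem_Ioo hθ).ne'
  refine Real.injOn_cos ⟨hθ.1.le, hθ.2.le⟩ ⟨by positivity, by linarith [Real.pi_pos]⟩ ?_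
  rw [h, Real.cos_pi_div_two]

theorem integral_neg_self_eq_integral_add_neg {E : Type*} [NormedAddCommGroup E]
    [NormedSpace ℝ E] {g : ℝ → E} (hg : Continuous g) (a : ℝ) :
    ∫ x in (-a)..a, g x = ∫ x in (0)..a, (g x + g (-x)) := by
  have hneg : Continuous fun x => g (-x) := hg.comp continuous_neg
  rw [intervalIntegral.integral_add (hg.intervalIntegrable _ _) (hneg.intervalIntegrable _ _),
    intervalIntegral.integral_comp_neg, neg_zero, add_comm,
    intervalIntegral.integral_add_adjacent_intervals (hg.intervalIntegrable _ _)
      (hg.intervalIntegrable _ _)]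

variable {θ : ℝ} {α β : ℂ}

theorem limitLaw_apply (hs : 0 < Real.sin θ) (h0 : coupling θ ≠ 0) (ha : |coupling θ| < 1 / 2)
    (hαβ : ‖α‖ ^ 2 + ‖β‖ ^ 2 = 1) {S : Set ℝ} (hS : MeasurableSet S) :
    limitLaw θ α β S = ENNReal.ofReal (∫ x in S, density θ α β x) := by
  rw [limitLaw, withDensity_apply _ hS, ofReal_integral_eq_lintegral_ofReal
    (integrable_density hs h0 ha α β).integrableOn
    (.of_forall fun x => density_nonneg hs h0 ha hαβ x)]

theorem isProbabilityMeasure_limitLaw (hs : 0 < Real.sin θ) (h0 : coupling θ ≠ 0)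
    (ha : |coupling θ| < 1 / 2) (hαβ : ‖α‖ ^ 2 + ‖β‖ ^ 2 = 1) :
    IsProbabilityMeasure (limitLaw θ α β) := by
  constructor
  rw [limitLaw_apply hs h0 ha hαβ MeasurableSet.univ, setIntegral_univ,
    integral_density hs h0 ha, ENNReal.ofReal_one]

theorem charFun_limitLaw (hs : 0 < Real.sin θ) (h0 : coupling θ ≠ 0) (ha : |coupling θ| < 1 / 2)
    (hαβ : ‖α‖ ^ 2 + ‖β‖ ^ 2 = 1) (ξ : ℝ) :
    charFun (limitLaw θ α β) ξ
      = (2 * Real.pi : ℂ)⁻¹ * ∫ k in (-Real.pi)..Real.pi, ∑ ε : ℤˣ,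
          Complex.exp (ξ * ((ε : ℤ) * speed (coupling θ) k : ℝ) * I)
            * (‖component θ α β ε k‖ : ℂ) ^ 2 := by
  have hv := continuous_speed ha
  have hφ := continuous_component ha α β
  rw [charFun_apply_real, limitLaw, integral_withDensity_eq_integral_toReal_smul
    (measurable_density θ α β).ennreal_ofReal (.of_forall fun _ => ENNReal.ofReal_lt_top)]
  simp only [ENNReal.toReal_ofReal (density_nonneg hs h0 ha hαβ _)]
  rw [integral_density_smul hs h0 ha α β (G := fun x : ℝ => Complex.exp (ξ * x * I))
    (by fun_prop), intervalIntegral.integral_finsetSum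
    fun ε _ => Continuous.intervalIntegrable (by fun_prop) _ _, Finset.mul_sum]
  refine Finset.sum_congr rfl fun ε _ => ?_
  rw [integral_neg_self_eq_integral_add_neg (by fun_prop), ← intervalIntegral.integral_const_mul]
  congr 1 with k
  rw [speed_neg, ← mul_add, ← norm_sq_component_add_norm_sq_component_neg ha hαβ,
    Complex.real_smul]
  push_cast
  ring

theorem tendsto_charFun_positionLaw (hs : 0 < Real.sin θ) (h0 : coupling θ ≠ 0)
    (ha : |coupling θ| < 1 / 2) (hαβ : ‖α‖ ^ 2 + ‖β‖ ^ 2 = 1) (ξ : ℝ) :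
    Tendsto (fun t : ℕ => charFun ((positionLaw θ α β t).map fun n : ℤ => (n : ℝ) / t) ξ) atTop
      (𝓝 (charFun (limitLaw θ α β) ξ)) := by
  rw [charFun_limitLaw hs h0 ha hαβ]
  exact (isBandSystem ha α β).tendsto_charFun_bornLaw (support_walk_finite θ α β)
    (hasSum_wave_walk ha α β) ξ

theorem tendstoInDistribution_positionLaw (hs : 0 < Real.sin θ) (h0 : coupling θ ≠ 0)
    (ha : |coupling θ| < 1 / 2) (hαβ : ‖α‖ ^ 2 + ‖β‖ ^ 2 = 1)
    [∀ t, IsProbabilityMeasure (positionLaw θ α β t)] [IsProbabilityMeasure (limitLaw θ α β)] :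
    TendstoInDistribution (fun (t : ℕ) (n : ℤ) => (n : ℝ) / t) atTop (fun x : ℝ => x)
      (positionLaw θ α β) (limitLaw θ α β) where
  forall_aemeasurable t := by fun_prop
  aemeasurable_limit := aemeasurable_id
  tendsto := by
    refine ProbabilityMeasure.tendsto_iff_tendsto_charFun.2 fun ξ => ?_
    simpa only [ProbabilityMeasure.coe_mk, Measure.map_id'] using
      tendsto_charFun_positionLaw hs h0 ha hαβ ξ

theorem tendsto_positionLaw_real (hs : 0 < Real.sin θ) (h0 : coupling θ ≠ 0)
    (ha : |coupling θ| < 1 / 2) (hαβ : ‖α‖ ^ 2 + ‖β‖ ^ 2 = 1) {S : Set ℝ} (hS : MeasurableSet S)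
    (hfr : volume (frontier S) = 0) :
    Tendsto (fun t : ℕ => (positionLaw θ α β t).real {n : ℤ | (n : ℝ) / t ∈ S}) atTop
      (𝓝 (∫ x in S, density θ α β x)) := by
  have hp := isProbabilityMeasure_positionLaw ha hαβ
  have hl := isProbabilityMeasure_limitLaw hs h0 ha hαβ
  have hfr_limit : limitLaw θ α β (frontier S) = 0 :=
    withDensity_absolutelyContinuous volume _ hfr
  have hlim := ProbabilityMeasure.tendsto_measure_of_null_frontier_of_tendsto'
    (tendstoInDistribution_positionLaw hs h0 ha hαβ).tendsto (E := S)
    (by simpa only [ProbabilityMeasure.coe_mk, Measure.map_id'] using hfr_limit)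
  simp only [ProbabilityMeasure.coe_mk, Measure.map_id'] at hlim
  have hreal := (ENNReal.tendsto_toReal (measure_ne_top (limitLaw θ α β) S)).comp hlim
  rw [limitLaw_apply hs h0 ha hαβ hS, ENNReal.toReal_ofReal
    (integral_nonneg fun x => density_nonneg hs h0 ha hαβ x)] at hreal
  refine hreal.congr fun t => ?_
  rw [Function.comp_apply, Measure.map_apply (by fun_prop) hS]
  rfl

theorem innerEdge_pos (hs : 0 < Real.sin θ) (ha : |coupling θ| < 1 / 2) : 0 < innerEdge θ := by
  rw [innerEdge, cs_eq_abs_coupling hs]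
  exact Real.sqrt_pos.2 (by linarith)

theorem density_eq_zero_of_abs_le {x : ℝ} (hx : |x| ≤ innerEdge θ) : density θ α β x = 0 :=
  density_eq_zero (fun h => ((le_abs_self x).trans hx).not_gt h.1)
    fun h => ((neg_le_abs x).trans hx).not_gt h.1

theorem tendsto_positionLaw_real_abs_le_innerEdge (hs : 0 < Real.sin θ) (h0 : coupling θ ≠ 0)
    (ha : |coupling θ| < 1 / 2) (hαβ : ‖α‖ ^ 2 + ‖β‖ ^ 2 = 1) :
    Tendsto (fun t : ℕ => (positionLaw θ α β t).real {n : ℤ | |(n : ℝ) / t| ≤ innerEdge θ}) atTop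
      (𝓝 0) := by
  have hpos := innerEdge_pos hs ha
  have hfr : volume (frontier (Set.Icc (-innerEdge θ) (innerEdge θ))) = 0 := by
    rw [frontier_Icc (by linarith)]
    exact (Set.toFinite _).measure_zero _
  have hgap : ∫ x in Set.Icc (-innerEdge θ) (innerEdge θ), density θ α β x = 0 :=
    setIntegral_eq_zero_of_forall_eq_zero fun x hx => density_eq_zero_of_abs_le (abs_le.2 hx)
  have h := tendsto_positionLaw_real hs h0 ha hαβ measurableSet_Icc hfr
  rw [hgap] at h
  simpa only [Set.mem_Icc, ← abs_le] using h

end Convergence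

end GapWalk

end

theorem theorem2 (θ : ℝ) (hθ : θ ∈ Set.Ioo 0 Real.pi) (hθ₁ : θ ≠ Real.pi / 4)
    (hθ₂ : θ ≠ Real.pi / 2) (hθ₃ : θ ≠ 3 * Real.pi / 4)
    (α β : ℂ) (hαβ : ‖α‖ ^ 2 + ‖β‖ ^ 2 = 1) :
    -- the density is a probability density, supported on the two intervals
    (∀ x, 0 ≤ GapWalk.density θ α β x) ∧
    Integrable (GapWalk.density θ α β) ∧
    ∫ x, GapWalk.density θ α β x = 1 ∧
    Function.support (GapWalk.density θ α β) ⊆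
      Set.Ioo (-GapWalk.outerEdge θ) (-GapWalk.innerEdge θ) ∪
        Set.Ioo (GapWalk.innerEdge θ) (GapWalk.outerEdge θ) ∧
    -- convergence of the distribution functions of `X_t / t`
    (∀ x : ℝ, Tendsto
      (fun t : ℕ => (GapWalk.positionLaw θ α β t).real {n : ℤ | (n : ℝ) / t ≤ x}) atTop
      (𝓝 (∫ y in Set.Iic x, GapWalk.density θ α β y))) ∧
    -- weak convergence of `X_t / t` to the limit law
    (∃ (_ : ∀ t, IsProbabilityMeasure (GapWalk.positionLaw θ α β t))
      (_ : IsProbabilityMeasure (GapWalk.limitLaw θ α β)),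
      TendstoInDistribution (fun (t : ℕ) (n : ℤ) => (n : ℝ) / t) atTop (fun x : ℝ => x)
        (GapWalk.positionLaw θ α β) (GapWalk.limitLaw θ α β)) ∧
    -- the gap around the origin
    0 < GapWalk.innerEdge θ ∧
    Tendsto (fun t : ℕ => (GapWalk.positionLaw θ α β t).real
      {n : ℤ | |(n : ℝ) / t| ≤ GapWalk.innerEdge θ}) atTop (𝓝 0) := by
  have hs := Real.sin_pos_of_mem_Ioo hθ
  have h0 := GapWalk.coupling_ne_zero hθ hθ₂
  have ha := GapWalk.abs_coupling_lt_half (GapWalk.cos_two_mul_ne_zero hθ hθ₁ hθ₃)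
  have hp := GapWalk.isProbabilityMeasure_positionLaw ha hαβ
  have hl := GapWalk.isProbabilityMeasure_limitLaw hs h0 ha hαβ
  have hcdf (x : ℝ) := GapWalk.tendsto_positionLaw_real hs h0 ha hαβ
    (measurableSet_Iic (a := x)) (by rw [frontier_Iic, Real.volume_singleton])
  exact ⟨GapWalk.density_nonneg hs h0 ha hαβ, GapWalk.integrable_density hs h0 ha α β,
    GapWalk.integral_density hs h0 ha α β, GapWalk.support_density_subset θ α β, hcdf,
    ⟨hp, hl, GapWalk.tendstoInDistribution_positionLaw hs h0 ha hαβ⟩,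
    GapWalk.innerEdge_pos hs ha, GapWalk.tendsto_positionLaw_real_abs_le_innerEdge hs h0 ha hαβ⟩
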